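/- **Proposition (Simonenko's principle).** Let $M$ be a closed (compact, Hausdorff, without boundary) smooth manifold of dimension $n\ge 1$, equipped with a smooth Riemannian metric with volume measure $\mathrm{dvol}$, and let $E$ be a hermitian vector bundle on $M$, that is, a complex vector bundle of finite rank with a continuously varying inner product on its fibres. Let $L^2(M,E)$ be the Hilbert space of square integrable measurable sections of $E$ (modulo equality almost everywhere), with inner product $\int_M \langle s,t\rangle\,\mathrm{dvol}$, and for $\phi\in C(M)$ (continuous complex valued functions) let $M_\phi$ denote the operator of multiplication by $\phi$ on $L^2(M,E)$. Let $\Psi_M(L^2(M,E))$ be the set of all bounded operators $P$ on $L^2(M,E)$ such that $M_\phi P M_\psi$ is compact for all $\phi,\psi\in C(M)$ with disjoint supports. A bounded operator $P$ on $L^2(M,E)$ is called locally invertible at $x\in M$ if there are a neighbourhood $V_x$ of $x$ and bounded operators $Q_1^x,Q_2^x$ on $L^2(M,E)$ such that $$Q_1^x P M_\phi = M_\phi = M_\phi P Q_2^x$$ for every $\phi\in C(M)$ with support contained in $V_x$; it is called locally invertible on $M$ if it is locally invertible at every $x\in M$. Let $P\in\Psi_M(L^2(M,E))$. Then $P$ is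 locally invertible on $M$ if and only if $P$ is Fredholm. -/

import Mathlib

open MeasureTheory Topology Bundle
open scoped Manifold ContDiff InnerProductSpace

noncomputable section

namespace Simonenko

/-! ### Local invertibility and the essentially local operators -/

section General

variable {T : Type*} [TopologicalSpace T] [CompactSpace T]
  {H : Type*} [NormedAddCommGroup H] [InnerProductSpace ℂ H] [CompleteSpace H]

/-- For a representation `m` of `C(T)` on the Hilbert space `H`, the operator `P` is
*locally invertible at* `x` if there are a neighbourhood `V` of `x` and operators `Q₁`, `Q₂` with
`Q₁ P M_φ = M_φ = M_φ P Q₂` for every continuous function `φ` supported in `V`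
(supports are closed, hence compact, because `T` is compact). -/
def IsLocallyInvertibleAt (m : C(T, ℂ) →⋆ₐ[ℂ] (H →L[ℂ] H)) (P : H →L[ℂ] H) (x : T) : Prop :=
  ∃ V ∈ 𝓝 x, ∃ Q₁ Q₂ : H →L[ℂ] H, ∀ φ : C(T, ℂ), tsupport φ ⊆ V →
    Q₁ ∘L P ∘L m φ = m φ ∧ m φ ∘L P ∘L Q₂ = m φ

/-- `P` is *locally invertible on* `T` if it is locally invertible at every point of `T`. -/
def IsLocallyInvertible (m : C(T, ℂ) →⋆ₐ[ℂ] (H →L[ℂ] H)) (P : H →L[ℂ] H) : Prop :=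
  ∀ x : T, IsLocallyInvertibleAt m P x

/-- `Ψ_T(H)`: the operators `P` such that `M_φ P M_ψ` is compact whenever the continuous functions
`φ` and `ψ` have disjoint supports. -/
def Psi (m : C(T, ℂ) →⋆ₐ[ℂ] (H →L[ℂ] H)) : Set (H →L[ℂ] H) :=
  {P | ∀ φ ψ : C(T, ℂ), Disjoint (tsupport φ) (tsupport ψ) →
    IsCompactOperator (m φ ∘L P ∘L m ψ)}

end General

/-! ### The volume measure of a Riemannian manifold -/

section Volume

/-- The inverse of a chart is measurable for the measure which `chartVolume` transports, so that
`Measure.map` does not take its default value there. -/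
theorem aemeasurable_chart_symm {n : ℕ} {M : Type*} [TopologicalSpace M] [MeasurableSpace M]
    [BorelSpace M]
    (e : OpenPartialHomeomorph M (EuclideanSpace ℝ (Fin n)))
    (ρ : EuclideanSpace ℝ (Fin n) → ENNReal) :
    AEMeasurable e.symm ((volume.restrict e.target).withDensity ρ) :=
  (e.continuousOn_symm.aemeasurable e.open_target.measurableSet).mono_ac
    (withDensity_absolutelyContinuous _ _)

variable {n : ℕ} {M : Type*} [TopologicalSpace M] [ChartedSpace (EuclideanSpace ℝ (Fin n)) M]
  [IsManifold (𝓡 n) ∞ M]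

/-- The Gram matrix `(g(∂ᵢ, ∂ⱼ))` of the Riemannian metric `g` in the chart `e`, at the point
`u` of the target of `e`. The `i`-th coordinate vector field `∂ᵢ` is the image of the `i`-th
standard basis vector under the derivative of the inverse of the chart. -/
def gramMatrix
    (g : ContMDiffRiemannianMetric (𝓡 n) ∞ (EuclideanSpace ℝ (Fin n))
      (fun x : M ↦ TangentSpace (𝓡 n) x))
    (e : OpenPartialHomeomorph M (EuclideanSpace ℝ (Fin n))) (u : EuclideanSpace ℝ (Fin n)) :
    Matrix (Fin n) (Fin n) ℝ :=
  Matrix.of fun i j ↦ g.inner (e.symm u)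
    (mfderiv (𝓡 n) (𝓡 n) e.symm u (EuclideanSpace.single i (1 : ℝ)))
    (mfderiv (𝓡 n) (𝓡 n) e.symm u (EuclideanSpace.single j (1 : ℝ)))

variable [MeasurableSpace M]

/-- The Riemannian volume measure on the domain of the chart `e` (extended by zero to `M`): the
measure `√(det g) du₁ ⋯ duₙ` on the target of `e`, transported to `M`. -/
def chartVolume
    (g : ContMDiffRiemannianMetric (𝓡 n) ∞ (EuclideanSpace ℝ (Fin n))
      (fun x : M ↦ TangentSpace (𝓡 n) x))
    (e : OpenPartialHomeomorph M (EuclideanSpace ℝ (Fin n))) : Measure M :=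
  ((volume.restrict e.target).withDensity
    fun u ↦ ENNReal.ofReal (Real.sqrt (gramMatrix g e u).det)).map e.symm

/-- The Riemannian volume measure of `(M, g)`. By the change of variables formula the measures
`chartVolume g e` agree on the overlaps of the charts, so that (for second countable `M`) their
supremum in the lattice of measures is the measure which restricts to each of them. -/
def riemannianVolume
    (g : ContMDiffRiemannianMetric (𝓡 n) ∞ (EuclideanSpace ℝ (Fin n))
      (fun x : M ↦ TangentSpace (𝓡 n) x)) : Measure M :=
  ⨆ e ∈ atlas (EuclideanSpace ℝ (Fin n)) M, chartVolume g e

end Volume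

/-! ### Hermitian bundles and their square integrable sections -/

section Bundle

variable {B : Type*} [TopologicalSpace B]
  (F : Type*) [NormedAddCommGroup F] [NormedSpace ℂ F]
  (E : B → Type*) [TopologicalSpace (TotalSpace F E)]
  [∀ x, NormedAddCommGroup (E x)] [∀ x, InnerProductSpace ℂ (E x)]
  [FiberBundle F E] [VectorBundle ℂ F E]

/-- A complex vector bundle whose fibres carry inner products (inducing the topology of the fibres)
is *hermitian* if the inner products depend continuously on the base point, that is, if the inner
product of any two sections that are constant in a local trivialization is continuous. -/
class IsHermitianBundle : Prop where
  continuousOn_inner : ∀ (e : Trivialization F (π F E)) [MemTrivializationAtlas e] (v w : F),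
    ContinuousOn (fun x ↦ ⟪e.symm x v, e.symm x w⟫_ℂ) e.baseSet

variable [MeasurableSpace B]

variable {E} in
/-- A section of `E` is measurable if it is so in every local trivialization. -/
def IsMeasurableSection (s : Π x, E x) : Prop :=
  ∀ (e : Trivialization F (π F E)) [MemTrivializationAtlas e],
    StronglyMeasurable fun x : e.baseSet ↦ (e ⟨(x : B), s x⟩).2

variable {F E}

theorem IsMeasurableSection.zero : IsMeasurableSection F (0 : Π x, E x) := by
  intro e _
  have : (fun x : e.baseSet ↦ (e ⟨(x : B), (0 : Π x, E x) x⟩).2) = fun _ ↦ 0 := by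
    funext x
    exact (e.linear ℂ x.2).map_zero
  rw [this]
  exact stronglyMeasurable_const

theorem IsMeasurableSection.add {s t : Π x, E x} (hs : IsMeasurableSection F s)
    (ht : IsMeasurableSection F t) : IsMeasurableSection F (s + t) := by
  intro e _
  have : (fun x : e.baseSet ↦ (e ⟨(x : B), (s + t) x⟩).2) =
      fun x : e.baseSet ↦ (e ⟨(x : B), s x⟩).2 + (e ⟨(x : B), t x⟩).2 := by
    funext x
    exact (e.linear ℂ x.2).map_add _ _
  rw [this]
  exact (hs e).add (ht e)

variable [BorelSpace B]

theorem IsMeasurableSection.smul {s : Π x, E x} (hs : IsMeasurableSection F s) {f : B → ℂ}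
    (hf : Continuous f) : IsMeasurableSection F (fun x ↦ f x • s x) := by
  intro e _
  have : (fun x : e.baseSet ↦ (e ⟨(x : B), f x • s x⟩).2) =
      fun x : e.baseSet ↦ f x • (e ⟨(x : B), s x⟩).2 := by
    funext x
    exact (e.linear ℂ x.2).map_smul _ _
  rw [this]
  exact (hf.measurable.stronglyMeasurable.comp_measurable measurable_subtype_coe).smul (hs e)

variable [CompactSpace B] [FiniteDimensional ℂ F] [IsHermitianBundle F E]

theorem IsMeasurableSection.measurable_inner {s t : Π x, E x} (hs : IsMeasurableSection F s)
    (ht : IsMeasurableSection F t) : Measurable fun x ↦ ⟪s x, t x⟫_ℂ := by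
  have key : ∀ (e : Trivialization F (π F E)) [MemTrivializationAtlas e],
      Measurable fun x : e.baseSet ↦ ⟪s x, t x⟫_ℂ := by
    intro e _
    let b := Module.finBasis ℂ F
    have expand : ∀ (r : Π x, E x) (x : e.baseSet), r x =
        ∑ i, b.repr (e ⟨(x : B), r x⟩).2 i • e.symm (x : B) (b i) := by
      intro r x
      have h1 : e.symmₗ ℂ (x : B) (e ⟨(x : B), r x⟩).2 = r x := by
        rw [e.coe_symmₗ x.2]
        exact e.symm_apply_apply_mk x.2 (r x)
      have h2 := congrArg (e.symmₗ ℂ (x : B)) (b.sum_repr (e ⟨(x : B), r x⟩).2)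
      rw [h1, map_sum] at h2
      refine h2.symm.trans (Finset.sum_congr rfl fun i _ ↦ ?_)
      rw [map_smul, e.coe_symmₗ x.2]
    have coord : ∀ (r : Π x, E x), IsMeasurableSection F r → ∀ i,
        Measurable fun x : e.baseSet ↦ b.repr (e ⟨(x : B), r x⟩).2 i := by
      intro r hr i
      have hc : Continuous fun v : F ↦ b.repr v i :=
        LinearMap.continuous_of_finiteDimensional (b.coord i)
      exact (hc.comp_stronglyMeasurable (hr e)).measurable
    have : (fun x : e.baseSet ↦ ⟪s x, t x⟫_ℂ) = fun x : e.baseSet ↦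
        ∑ i, ∑ j, (starRingEnd ℂ) (b.repr (e ⟨(x : B), s x⟩).2 i) *
          (b.repr (e ⟨(x : B), t x⟩).2 j * ⟪e.symm (x : B) (b i), e.symm (x : B) (b j)⟫_ℂ) := by
      funext x
      conv_lhs => rw [expand s x, expand t x]
      simp only [sum_inner]
      refine Finset.sum_congr rfl fun i _ ↦ ?_
      simp only [inner_sum, inner_smul_left, inner_smul_right]
      refine Finset.sum_congr rfl fun j _ ↦ ?_
      ring
    rw [this]
    refine Finset.measurable_sum _ fun i _ ↦ Finset.measurable_sum _ fun j _ ↦ ?_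
    refine (Complex.continuous_conj.measurable.comp (coord s hs i)).mul ((coord t ht j).mul ?_)
    exact (continuousOn_iff_continuous_domRestrict.1
      (IsHermitianBundle.continuousOn_inner e (b i) (b j))).measurable
  obtain ⟨τ, -, hτ⟩ := isCompact_univ.elim_nhds_subcover
    (fun y : B ↦ (trivializationAt F E y).baseSet)
    (fun y _ ↦ (trivializationAt F E y).open_baseSet.mem_nhds
      (FiberBundle.mem_baseSet_trivializationAt' y))
  intro A hA
  have : (fun x ↦ ⟪s x, t x⟫_ℂ) ⁻¹' A = ⋃ y ∈ τ, Subtype.val ''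
      ((fun x : (trivializationAt F E y).baseSet ↦ ⟪s x, t x⟫_ℂ) ⁻¹' A) := by
    ext x
    simp only [Set.mem_iUnion]
    constructor
    · intro hx
      obtain ⟨y, hy, hxy⟩ := Set.mem_iUnion₂.1 (hτ (Set.mem_univ x))
      exact ⟨y, hy, ⟨x, hxy⟩, hx, rfl⟩
    · rintro ⟨y, hy, ⟨x, hxy⟩, hx, rfl⟩
      exact hx
  rw [this]
  exact Finset.measurableSet_biUnion _ fun y _ ↦
    (trivializationAt F E y).open_baseSet.measurableSet.subtype_image (key _ hA)

theorem IsMeasurableSection.measurable_norm {s : Π x, E x} (hs : IsMeasurableSection F s) :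
    Measurable fun x ↦ ‖s x‖ := by
  have : (fun x ↦ ‖s x‖) = fun x ↦ Real.sqrt (RCLike.re ⟪s x, s x⟫_ℂ) := by
    funext x
    exact norm_eq_sqrt_re_inner _
  rw [this]
  exact (RCLike.measurable_re.comp (hs.measurable_inner hs)).sqrt

variable (F E) in
/-- The vector space of measurable sections `s` of `E` with `∫ ‖s‖² dμ < ∞`. -/
def sqIntegrableSections (μ : Measure B) : Submodule ℂ (Π x, E x) where
  carrier := {s | IsMeasurableSection F s ∧ MemLp (fun x ↦ ‖s x‖) 2 μ}
  zero_mem' := ⟨.zero, by simp⟩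
  add_mem' := by
    rintro s t ⟨hs, hs'⟩ ⟨ht, ht'⟩
    refine ⟨hs.add ht, (hs'.add ht').mono (hs.add ht).measurable_norm.aestronglyMeasurable ?_⟩
    refine Filter.Eventually.of_forall fun x ↦ ?_
    simp only [Pi.add_apply, Real.norm_eq_abs]
    rw [abs_of_nonneg (norm_nonneg _), abs_of_nonneg (by positivity)]
    exact norm_add_le _ _
  smul_mem' := by
    rintro c s ⟨hs, hs'⟩
    refine ⟨hs.smul (continuous_const (y := c)), ?_⟩
    simp only [Pi.smul_apply, norm_smul]
    exact hs'.const_mul ‖c‖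

variable (F E) in
/-- A copy of `sqIntegrableSections F E μ`, to be endowed with the `L²` seminorm. -/
def SqIntegrableSection (μ : Measure B) : Type _ := sqIntegrableSections F E μ

variable {μ : Measure B}

instance : AddCommGroup (SqIntegrableSection F E μ) :=
  inferInstanceAs (AddCommGroup (sqIntegrableSections F E μ))

instance : Module ℂ (SqIntegrableSection F E μ) :=
  inferInstanceAs (Module ℂ (sqIntegrableSections F E μ))

instance : CoeFun (SqIntegrableSection F E μ) fun _ ↦ Π x, E x := ⟨fun s ↦ s.1⟩

theorem SqIntegrableSection.integrable_inner (s t : SqIntegrableSection F E μ) :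
    Integrable (fun x ↦ ⟪s x, t x⟫_ℂ) μ := by
  refine (MemLp.integrable_mul s.2.2 t.2.2).mono
    (s.2.1.measurable_inner t.2.1).aestronglyMeasurable (Filter.Eventually.of_forall fun x ↦ ?_)
  simp only [Pi.mul_apply, norm_mul, norm_norm]
  exact norm_inner_le_norm _ _

/-- The positive semidefinite inner product `∫ ⟪s, t⟫ dμ` of square integrable sections. -/
@[reducible] def SqIntegrableSection.core :
    PreInnerProductSpace.Core ℂ (SqIntegrableSection F E μ) where
  inner s t := ∫ x, ⟪s x, t x⟫_ℂ ∂μ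
  conj_inner_symm s t := by
    rw [← integral_conj]
    simp
  re_inner_nonneg s := by
    rw [← integral_re (s.integrable_inner s)]
    exact integral_nonneg fun x ↦ inner_self_nonneg
  add_left r s t := by
    rw [← integral_add (r.integrable_inner t) (s.integrable_inner t)]
    exact integral_congr_ae (Filter.Eventually.of_forall fun x ↦ inner_add_left _ _ _)
  smul_left s t c := by
    rw [← integral_const_mul]
    exact integral_congr_ae (Filter.Eventually.of_forall fun x ↦ inner_smul_left _ _ _)

instance : SeminormedAddCommGroup (SqIntegrableSection F E μ) :=
  InnerProductSpace.Core.toSeminormedAddCommGroup (c := SqIntegrableSection.core)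

instance : InnerProductSpace ℂ (SqIntegrableSection F E μ) :=
  InnerProductSpace.ofCore SqIntegrableSection.core

theorem SqIntegrableSection.inner_def (s t : SqIntegrableSection F E μ) :
    ⟪s, t⟫_ℂ = ∫ x, ⟪s x, t x⟫_ℂ ∂μ := rfl

variable (F E μ) in
/-- The Hilbert space `L²(B, E; μ)`: the Hausdorff completion of the space of square integrable
measurable sections for the `L²` seminorm (that is, these sections modulo equality almost
everywhere). -/
abbrev L2 : Type _ := UniformSpace.Completion (SqIntegrableSection F E μ)

/-- Multiplication of square integrable sections by a continuous function. -/
def mulSection (φ : C(B, ℂ)) : SqIntegrableSection F E μ →L[ℂ] SqIntegrableSection F E μ :=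
  LinearMap.mkContinuous
    { toFun := fun s ↦ ⟨fun x ↦ φ x • s x, s.2.1.smul φ.continuous, by
        refine (s.2.2.const_mul ‖φ‖).mono
          (s.2.1.smul φ.continuous).measurable_norm.aestronglyMeasurable
          (Filter.Eventually.of_forall fun x ↦ ?_)
        simp only [norm_smul, norm_mul, norm_norm]
        gcongr
        exact φ.norm_coe_le_norm x⟩
      map_add' := fun s t ↦ Subtype.ext (funext fun x ↦ smul_add _ _ _)
      map_smul' := fun c s ↦ Subtype.ext (funext fun x ↦ smul_comm _ _ _) }
    ‖φ‖ (by
      intro s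
      refine (sq_le_sq₀ (norm_nonneg _) (by positivity)).1 ?_
      rw [mul_pow, @norm_sq_eq_re_inner ℂ, @norm_sq_eq_re_inner ℂ _ _ _ _ s]
      rw [SqIntegrableSection.inner_def, SqIntegrableSection.inner_def,
        ← integral_re (SqIntegrableSection.integrable_inner _ _),
        ← integral_re (SqIntegrableSection.integrable_inner _ _), ← integral_const_mul]
      refine integral_mono (SqIntegrableSection.integrable_inner _ _).re
        ((SqIntegrableSection.integrable_inner _ _).re.const_mul _) fun x ↦ ?_
      change RCLike.re ⟪φ x • s x, φ x • s x⟫_ℂ ≤ ‖φ‖ ^ 2 * RCLike.re ⟪s x, s x⟫_ℂ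
      rw [← norm_sq_eq_re_inner, ← norm_sq_eq_re_inner, norm_smul, mul_pow]
      gcongr
      exact φ.norm_coe_le_norm x)

theorem mulSection_apply (φ : C(B, ℂ)) (s : SqIntegrableSection F E μ) (x : B) :
    mulSection φ s x = φ x • s x := rfl

/-- Two operators on `L²` that agree on square integrable sections are equal. -/
theorem L2.clm_ext {A A' : L2 F E μ →L[ℂ] L2 F E μ}
    (h : ∀ s : SqIntegrableSection F E μ, A s = A' s) : A = A' :=
  ContinuousLinearMap.ext fun x ↦ UniformSpace.Completion.induction_on x
    (isClosed_eq A.continuous A'.continuous) h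

variable (F E μ) in
/-- The representation `φ ↦ M_φ` of `C(B)` on `L²(B, E; μ)` by multiplication operators. -/
def mulRep : C(B, ℂ) →⋆ₐ[ℂ] (L2 F E μ →L[ℂ] L2 F E μ) where
  toFun φ := (mulSection φ).completion
  map_one' := by
    refine L2.clm_ext fun s ↦ ?_
    rw [ContinuousLinearMap.completion_apply_coe]
    exact congrArg _ (Subtype.ext (funext fun x ↦ one_smul ℂ (s x)))
  map_mul' φ ψ := by
    refine L2.clm_ext fun s ↦ ?_
    rw [mul_apply_eq_comp]
    simp only [ContinuousLinearMap.completion_apply_coe]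
    exact congrArg _ (Subtype.ext (funext fun x ↦ mul_smul (φ x) (ψ x) (s x)))
  map_zero' := by
    refine L2.clm_ext fun s ↦ ?_
    rw [ContinuousLinearMap.completion_apply_coe, zero_apply,
      ← UniformSpace.Completion.coe_zero]
    exact congrArg _ (Subtype.ext (funext fun x ↦ zero_smul ℂ (s x)))
  map_add' φ ψ := by
    refine L2.clm_ext fun s ↦ ?_
    rw [add_apply]
    simp only [ContinuousLinearMap.completion_apply_coe]
    rw [← UniformSpace.Completion.coe_add]
    exact congrArg _ (Subtype.ext (funext fun x ↦ add_smul (φ x) (ψ x) (s x)))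
  commutes' c := by
    refine L2.clm_ext fun s ↦ ?_
    rw [ContinuousLinearMap.completion_apply_coe, Algebra.algebraMap_eq_smul_one,
      Algebra.algebraMap_eq_smul_one, smul_apply,
      one_apply_eq_self, ← UniformSpace.Completion.coe_smul]
    refine congrArg _ (Subtype.ext (funext fun x ↦ ?_))
    change (c • (1 : ℂ)) • s x = c • s x
    rw [smul_eq_mul, mul_one]
  map_star' φ := by
    rw [ContinuousLinearMap.star_eq_adjoint, ContinuousLinearMap.eq_adjoint_iff]
    intro x y
    refine UniformSpace.Completion.induction_on₂ x y
      (isClosed_eq (by fun_prop) (by fun_prop)) fun s t ↦ ?_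
    simp only [ContinuousLinearMap.completion_apply_coe, UniformSpace.Completion.inner_coe,
      SqIntegrableSection.inner_def, mulSection_apply]
    refine integral_congr_ae (Filter.Eventually.of_forall fun x ↦ ?_)
    simp only [ContinuousMap.star_apply, inner_smul_left, inner_smul_right, RCLike.star_def,
      RCLike.conj_conj]

end Bundle

end Simonenko

end

/-!
Write `m φ` for the operator of multiplication by `φ`. Both implications are proved for a
representation `m` of `C(T)`, with `T` compact Hausdorff, on a Hilbert space.

*Locally invertible operators are Fredholm.* The main point is that an operator `P` in `Psi m`
commutes with real continuous functions `φ` up to compact operators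
(`isCompactOperator_commutator`). Let `χ i` be functions with `∑ i, χ i ^ 2 = 1`, each supported
where `φ` takes values in a short interval, in such a way that only the supports of neighbours meet.
Then the commutator is the sum of the operators `χ i ^ 2 [m φ, P] χ j ^ 2`. If `i` and `j` are far
apart, this operator is compact by hypothesis. If they are close, `φ` may be replaced by
`φ - λ` with a constant `λ` such that `φ - λ` is small on the supports of `χ i` and `χ j`; a
Cauchy-Schwarz estimate (`norm_sum_adjoint_mul_mul_le`) shows that the sum of these terms is small.
So the commutator is a limit of compact operators. Given local inverses `A i`, `B i` and a
subordinate partition of unity `f i`, the operators `∑ i, A i * m (f i)` and `∑ i, m (f i) * B i`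
then are a left and a right inverse of `P` modulo compact operators
(`IsLocallyInvertible.isFredholm`), and compact operators are finite rank up to a small error
(`isFredholm_of_isCompactOperator`).

*Fredholm operators are locally invertible.* Let `Q` invert `P` up to finite rank operators. If
points are null sets, then `m χ` tends to zero strongly as the support of `χ` shrinks to a point,
hence in norm after composition with a compact operator. So for a cutoff function `χ` that is `1`
near `x` and has small support, `Q P m χ` and `m χ P Q` differ from `m χ` by operators of norm less than
one, and a Neumann series corrects `Q` to local inverses (`HasNoAtoms.isLocallyInvertible`). This
applies to the Riemannian volume because the dimension is positive (`riemannianVolume_singleton`,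
`hasNoAtoms_mulRep`).
-/

namespace Simonenko

/-! ### Compact operators, finite rank operators and Fredholm operators -/

section Operators

variable {H : Type*} [NormedAddCommGroup H] [InnerProductSpace ℂ H]

theorem hasFiniteRange_starProjection (S : Submodule ℂ H) [FiniteDimensional ℂ S] :
    S.starProjection.toLinearMap.HasFiniteRange := by
  rw [LinearMap.hasFiniteRange_iff_range, Submodule.range_starProjection]
  exact Submodule.FG.of_finite

/-- Compact operators on a Hilbert space are norm limits of finite rank operators: compose with the
orthogonal projection onto the span of a finite net in the image of the unit ball. -/
theorem exists_hasFiniteRange_norm_sub_le {K : H →L[ℂ] H} (hK : IsCompactOperator K) {ε : ℝ}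
    (hε : 0 < ε) : ∃ G : H →L[ℂ] H, G.toLinearMap.HasFiniteRange ∧ ‖K - G‖ ≤ ε := by
  have hc := hK.isCompact_closure_image_closedBall (f := K.toLinearMap) 1
  obtain ⟨t, ht, hcov⟩ := Metric.totallyBounded_iff.1 hc.totallyBounded ε hε
  let S : Submodule ℂ H := Submodule.span ℂ t
  have : FiniteDimensional ℂ S := FiniteDimensional.span_of_finite ℂ ht
  refine ⟨S.starProjection * K, ?_, ?_⟩
  · exact (hasFiniteRange_starProjection S).comp_right K.toLinearMap
  · refine ContinuousLinearMap.opNorm_le_of_unit_norm hε.le fun x hx ↦ ?_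
    have hmem : K x ∈ closure (K.toLinearMap '' Metric.closedBall 0 1) :=
      subset_closure ⟨x, by simp [hx], rfl⟩
    obtain ⟨y, hy, hxy⟩ := Set.mem_iUnion₂.1 (hcov hmem)
    have hyS : y ∈ S := Submodule.subset_span hy
    have h1 : (K - S.starProjection * K) x = K x - S.starProjection (K x) := rfl
    have h2 : ‖K x - S.starProjection (K x)‖ ≤ ‖K x - y‖ := by
      rw [Submodule.starProjection_minimal]
      exact ciInf_le ⟨0, by rintro _ ⟨z, rfl⟩; positivity⟩ (⟨y, hyS⟩ : S)
    rw [h1]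
    refine h2.trans ?_
    rw [← dist_eq_norm]
    exact (Metric.mem_ball.1 hxy).le

/-- The adjoint of a finite rank operator `K` has finite rank, because `K† = K† ∘ Π` for the
orthogonal projection `Π` onto the range of `K`. -/
theorem hasFiniteRange_adjoint [CompleteSpace H] {K : H →L[ℂ] H}
    (hK : K.toLinearMap.HasFiniteRange) :
    (ContinuousLinearMap.adjoint K).toLinearMap.HasFiniteRange := by
  let S : Submodule ℂ H := K.range
  have : FiniteDimensional ℂ S := .of_fg hK.fg_range
  have hKS : S.starProjection * K = K := by
    ext x
    exact Submodule.starProjection_eq_self_iff.2 (LinearMap.mem_range_self K.toLinearMap x)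
  have h : ContinuousLinearMap.adjoint K = ContinuousLinearMap.adjoint K * S.starProjection := by
    have := congrArg star hKS
    rw [star_mul] at this
    rw [← ContinuousLinearMap.star_eq_adjoint]
    conv_lhs => rw [← this]
    congr 1
    exact (isStarProjection_starProjection (U := S)).isSelfAdjoint
  rw [h]
  exact (hasFiniteRange_starProjection S).comp_left (ContinuousLinearMap.adjoint K).toLinearMap

theorem isCompactOperator_of_hasFiniteRange {K : H →L[ℂ] H}
    (hK : K.toLinearMap.HasFiniteRange) : IsCompactOperator K := by
  let S : Submodule ℂ H := K.range
  have : FiniteDimensional ℂ S := .of_fg hK.fg_range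
  let L : H →L[ℂ] S := K.codRestrict S fun x ↦ LinearMap.mem_range_self K.toLinearMap x
  exact (isCompactOperator_of_locallyCompactSpace_rng S.subtypeL).comp_clm L

/-- An operator that is invertible modulo compact operators on either side is Fredholm
(one half of Atkinson's theorem). -/
theorem isFredholm_of_isCompactOperator [CompleteSpace H] {P A B : H →L[ℂ] H}
    (hA : IsCompactOperator (A * P - 1 : H →L[ℂ] H))
    (hB : IsCompactOperator (P * B - 1 : H →L[ℂ] H)) :
    P.IsFredholm := by
  -- `A P = 1 + K` with `K` close to a finite rank operator `G`, and `1 + K - G` is invertible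
  obtain ⟨G, hG, hG'⟩ := exists_hasFiniteRange_norm_sub_le hA one_half_pos
  obtain ⟨G', hGf', hGn'⟩ := exists_hasFiniteRange_norm_sub_le hB one_half_pos
  obtain ⟨u, hu⟩ : IsUnit (A * P - G) := by
    have := isUnit_one_sub_of_norm_lt_one (x := -(A * P - 1 - G))
      (by rw [norm_neg]; exact hG'.trans_lt (by norm_num))
    convert this using 1
    abel
  obtain ⟨v, hv⟩ : IsUnit (P * B - G') := by
    have := isUnit_one_sub_of_norm_lt_one (x := -(P * B - 1 - G'))
      (by rw [norm_neg]; exact hGn'.trans_lt (by norm_num))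
    convert this using 1
    abel
  let A' : H →L[ℂ] H := ↑u⁻¹ * A
  let B' : H →L[ℂ] H := B * ↑v⁻¹
  have hl : A' * P = 1 + ↑u⁻¹ * G := by
    have : A * P = u + G := by rw [hu]; abel
    simp only [A']
    rw [mul_assoc, this, mul_add, Units.inv_mul]
  have hr : P * B' = 1 + G' * ↑v⁻¹ := by
    have : P * B = v + G' := by rw [hv]; abel
    simp only [B']
    rw [← mul_assoc, this, add_mul, Units.mul_inv]
  -- the left and the right parametrix agree up to a finite rank operator
  have hAB : A' + A' * (G' * ↑v⁻¹) = B' + ↑u⁻¹ * G * B' := by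
    have := mul_assoc A' P B'
    rw [hl, hr] at this
    simpa [mul_add, add_mul] using this.symm
  refine ContinuousLinearMap.isFredholm_iff_exists_isQuasiInverse.2 ⟨A', ?_, ?_⟩
  · refine LinearMap.FiniteRangeSetoid.equiv_iff_hasFiniteRange.2 ?_
    have : A'.toLinearMap ∘ₗ P.toLinearMap - LinearMap.id =
        (↑u⁻¹ : H →L[ℂ] H).toLinearMap ∘ₗ G.toLinearMap := by
      change (A' * P - 1 : H →L[ℂ] H).toLinearMap = (↑u⁻¹ * G : H →L[ℂ] H).toLinearMap
      rw [hl, add_sub_cancel_left]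
    rw [this]
    exact hG.comp_left _
  · refine LinearMap.FiniteRangeSetoid.equiv_iff_hasFiniteRange.2 ?_
    change (P * A' - 1 : H →L[ℂ] H).toLinearMap.HasFiniteRange
    have h1 : (G' * ↑v⁻¹ : H →L[ℂ] H).toLinearMap.HasFiniteRange := hGf'.comp_right _
    have h2 : (↑u⁻¹ * G * B' : H →L[ℂ] H).toLinearMap.HasFiniteRange :=
      (hG.comp_left _).comp_right _
    clear_value A' B'
    generalize G' * (↑v⁻¹ : H →L[ℂ] H) = X at *
    generalize ↑u⁻¹ * G * B' = Y at *
    have h : P * A' - 1 = X + P * Y - P * A' * X := by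
      have : P * A' = P * B' + P * Y - P * A' * X := by
        rw [mul_assoc, ← mul_add, ← hAB, mul_add, add_sub_cancel_right]
      conv_lhs => rw [this, hr]
      abel
    rw [h]
    exact (h1.add (h2.comp_left P.toLinearMap)).sub (h1.comp_left (P * A').toLinearMap)

/-- A Cauchy-Schwarz estimate for sums of operators which are localized on both sides. -/
theorem norm_sum_adjoint_mul_mul_le [CompleteSpace H] {ι : Type*} (s : Finset ι)
    (a A b : ι → H →L[ℂ] H)
    {c k : ℝ} (hc : 0 ≤ c) (hk : 0 ≤ k) (hA : ∀ i ∈ s, ‖A i‖ ≤ c)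
    (ha : ∀ u, ∑ i ∈ s, ‖a i u‖ ^ 2 ≤ k * ‖u‖ ^ 2)
    (hb : ∀ u, ∑ i ∈ s, ‖b i u‖ ^ 2 ≤ k * ‖u‖ ^ 2) :
    ‖∑ i ∈ s, star (a i) * A i * b i‖ ≤ c * k := by
  refine ContinuousLinearMap.opNorm_le_bound _ (by positivity) fun u ↦ ?_
  set y := (∑ i ∈ s, star (a i) * A i * b i) u with hy
  have h1 : ‖y‖ ^ 2 ≤ ∑ i ∈ s, c * (‖b i u‖ * ‖a i y‖) := by
    have : ‖y‖ ^ 2 = ∑ i ∈ s, RCLike.re ⟪A i (b i u), a i y⟫_ℂ := by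
      rw [@norm_sq_eq_re_inner ℂ]
      conv_lhs => enter [2, 2]; rw [hy]
      rw [sum_apply, sum_inner, map_sum]
      refine Finset.sum_congr rfl fun i _ ↦ ?_
      rw [ContinuousLinearMap.star_eq_adjoint]
      exact congrArg _ (ContinuousLinearMap.adjoint_inner_left (a i) y (A i (b i u)))
    rw [this]
    refine Finset.sum_le_sum fun i hi ↦ ?_
    calc RCLike.re ⟪A i (b i u), a i y⟫_ℂ ≤ ‖A i (b i u)‖ * ‖a i y‖ := re_inner_le_norm _ _
      _ ≤ (c * ‖b i u‖) * ‖a i y‖ := by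
        gcongr
        exact (A i).le_of_opNorm_le (hA i hi) _
      _ = _ := by ring
  have h2 : ∑ i ∈ s, ‖b i u‖ * ‖a i y‖ ≤ k * ‖u‖ * ‖y‖ := by
    refine (Real.sum_mul_le_sqrt_mul_sqrt s _ _).trans ?_
    calc √(∑ i ∈ s, ‖b i u‖ ^ 2) * √(∑ i ∈ s, ‖a i y‖ ^ 2)
        ≤ √(k * ‖u‖ ^ 2) * √(k * ‖y‖ ^ 2) := by gcongr <;> simp [ha, hb]
      _ = k * ‖u‖ * ‖y‖ := by
        rw [Real.sqrt_mul hk, Real.sqrt_mul hk, Real.sqrt_sq (norm_nonneg _),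
          Real.sqrt_sq (norm_nonneg _)]
        linear_combination ‖u‖ * ‖y‖ * Real.mul_self_sqrt hk
  rw [← Finset.mul_sum] at h1
  rcases (norm_nonneg y).eq_or_lt with h0 | h0
  · rw [← h0]; positivity
  · refine le_of_mul_le_mul_right ?_ h0
    calc ‖y‖ * ‖y‖ = ‖y‖ ^ 2 := (sq _).symm
      _ ≤ c * (k * ‖u‖ * ‖y‖) := h1.trans (by gcongr)
      _ = _ := by ring

end Operators

/-! ### Commutators of essentially local operators with functions -/

section Bands

/-- The hat function of height one with support `[i, i + 2]` and peak at `i + 1`. -/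
noncomputable def hat (i : ℕ) (t : ℝ) : ℝ := max 0 (min 1 (t - i)) - max 0 (min 1 (t - (i + 1)))

theorem continuous_hat (i : ℕ) : Continuous (hat i) := by
  unfold hat
  fun_prop

theorem hat_nonneg (i : ℕ) (t : ℝ) : 0 ≤ hat i t := by
  unfold hat
  rw [sub_nonneg]
  gcongr
  linarith

theorem mem_Icc_of_hat_ne_zero {i : ℕ} {t : ℝ} (h : hat i t ≠ 0) :
    t ∈ Set.Icc (i : ℝ) (i + 2) := by
  contrapose! h
  rw [Set.mem_Icc, not_and_or, not_le, not_le] at h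
  unfold hat
  rcases h with h | h
  · rw [max_eq_left ((min_le_right _ _).trans (by linarith)),
      max_eq_left ((min_le_right _ _).trans (by linarith)), sub_self]
  · rw [min_eq_left (by linarith), min_eq_left (by linarith), sub_self]

theorem sum_range_hat {n : ℕ} {t : ℝ} (h1 : 1 ≤ t) (hn : t ≤ n) :
    ∑ i ∈ Finset.range n, hat i t = 1 := by
  have := Finset.sum_range_sub' (fun i : ℕ ↦ max 0 (min 1 (t - i))) n
  simp only [Nat.cast_add, Nat.cast_one] at this
  unfold hat
  rw [this, Nat.cast_zero, min_eq_left (by linarith),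
    max_eq_left (a := (0 : ℝ)) ((min_le_right _ _).trans (by linarith))]
  norm_num

variable {T : Type*} [TopologicalSpace T]

/-- The square root of the `i`-th hat function, pulled back along `τ : T → ℝ`. If
`1 ≤ τ ≤ n`, the squares of the first `n` of these functions form a partition of unity on `T`. -/
noncomputable def band (τ : C(T, ℝ)) (i : ℕ) : C(T, ℂ) :=
  ⟨fun x ↦ ((√(hat i (τ x)) : ℝ) : ℂ), by
    have := (continuous_hat i).comp τ.continuous
    exact Complex.continuous_ofReal.comp this.sqrt⟩

theorem star_band (τ : C(T, ℝ)) (i : ℕ) : star (band τ i) = band τ i := by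
  ext x
  exact Complex.conj_ofReal _

theorem mem_Icc_of_band_ne_zero {τ : C(T, ℝ)} {i : ℕ} {x : T} (h : band τ i x ≠ 0) :
    τ x ∈ Set.Icc (i : ℝ) (i + 2) := by
  refine mem_Icc_of_hat_ne_zero fun h0 ↦ h ?_
  simp [band, h0]

theorem mem_Icc_of_mem_tsupport_band {τ : C(T, ℝ)} {i : ℕ} {x : T} (h : x ∈ tsupport (band τ i)) :
    τ x ∈ Set.Icc (i : ℝ) (i + 2) :=
  closure_minimal (s := Function.support (band τ i)) (fun _ ↦ mem_Icc_of_band_ne_zero)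
    (isClosed_Icc.preimage τ.continuous) h

theorem sum_band_mul_band {τ : C(T, ℝ)} {n : ℕ} (h1 : ∀ x, 1 ≤ τ x) (hn : ∀ x, τ x ≤ n) :
    ∑ i ∈ Finset.range n, band τ i * band τ i = 1 := by
  ext x
  have : ∀ i, (band τ i * band τ i) x = ((hat i (τ x) : ℝ) : ℂ) := fun i ↦ by
    rw [← Real.mul_self_sqrt (hat_nonneg i (τ x)), Complex.ofReal_mul]
    rfl
  rw [ContinuousMap.sum_apply, Finset.sum_congr rfl fun i _ ↦ this i, ← Complex.ofReal_sum,
    sum_range_hat (h1 x) (hn x)]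
  simp

theorem norm_band_le [CompactSpace T] (τ : C(T, ℝ)) (i : ℕ) : ‖band τ i‖ ≤ 1 := by
  refine (ContinuousMap.norm_le _ zero_le_one).2 fun x ↦ ?_
  change ‖((√(hat i (τ x)) : ℝ) : ℂ)‖ ≤ 1
  rw [Complex.norm_real, Real.norm_of_nonneg (Real.sqrt_nonneg _), Real.sqrt_le_one]
  unfold hat
  have h1 : max 0 (min 1 (τ x - i)) ≤ 1 := max_le zero_le_one (min_le_left _ _)
  have h2 : 0 ≤ max 0 (min 1 (τ x - (i + 1))) := le_max_left _ _
  linarith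

/-- At most five bands have a support meeting that of a given band. -/
theorem card_filter_near_le (n j : ℕ) :
    ((Finset.range n).filter fun i ↦ i ≤ j + 2 ∧ j ≤ i + 2).card ≤ 5 := by
  have : ((Finset.range n).filter fun i ↦ i ≤ j + 2 ∧ j ≤ i + 2) ⊆ Finset.Icc (j - 2) (j + 2) := by
    intro i hi
    rw [Finset.mem_filter] at hi
    rw [Finset.mem_Icc]
    omega
  refine (Finset.card_le_card this).trans ?_
  rw [Nat.card_Icc]
  omega

end Bands

section Commutator

variable {T : Type*} [TopologicalSpace T] [CompactSpace T]
  {H : Type*} [NormedAddCommGroup H] [InnerProductSpace ℂ H] [CompleteSpace H]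

theorem norm_rep_le (m : C(T, ℂ) →⋆ₐ[ℂ] (H →L[ℂ] H)) (φ : C(T, ℂ)) : ‖m φ‖ ≤ ‖φ‖ :=
  NonUnitalStarAlgHom.norm_apply_le m φ

/-- The continuous real function `φ` as a complex one. -/
noncomputable def toComplex (φ : C(T, ℝ)) : C(T, ℂ) :=
  ⟨fun x ↦ (φ x : ℂ), Complex.continuous_ofReal.comp φ.continuous⟩

omit [CompactSpace T] in
theorem sum_norm_band_sq {m : C(T, ℂ) →⋆ₐ[ℂ] (H →L[ℂ] H)} {τ : C(T, ℝ)} {n : ℕ}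
    (h1 : ∀ x, 1 ≤ τ x) (hn : ∀ x, τ x ≤ n) (u : H) :
    ∑ i ∈ Finset.range n, ‖m (band τ i) u‖ ^ 2 = ‖u‖ ^ 2 := by
  have h (i : ℕ) : ‖m (band τ i) u‖ ^ 2 = RCLike.re ⟪m (band τ i * band τ i) u, u⟫_ℂ := by
    rw [@norm_sq_eq_re_inner ℂ]
    conv_rhs => rw [← star_band, star_band τ i, map_mul]
    rw [← ContinuousLinearMap.adjoint_inner_left, ← ContinuousLinearMap.star_eq_adjoint,
      ← map_star, star_band]
    rfl
  rw [Finset.sum_congr rfl fun i _ ↦ h i, ← map_sum, ← sum_inner, ← sum_apply, ← map_sum,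
    sum_band_mul_band h1 hn, map_one, @norm_sq_eq_re_inner ℂ]
  rfl

/-- On a band of `τ = (φ - c) / ε`, the function `φ` is nearly equal to its value `ε * i + c` at the
start of a neighbouring band. -/
theorem norm_sub_mul_band_le {φ τ : C(T, ℝ)} {ε c : ℝ} (hε : 0 < ε)
    (hτ : ∀ x, φ x = ε * τ x + c) {i j : ℕ} (hij : i ≤ j + 2) (hji : j ≤ i + 2) :
    ‖(toComplex φ - algebraMap ℂ _ ((ε * i + c : ℝ) : ℂ)) * band τ j‖ ≤ 4 * ε := by
  refine (ContinuousMap.norm_le _ (by positivity)).2 fun x ↦ ?_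
  have hval : ((toComplex φ - algebraMap ℂ _ ((ε * i + c : ℝ) : ℂ)) * band τ j) x =
      ((φ x - (ε * i + c) : ℝ) : ℂ) * band τ j x := by
    rw [Complex.ofReal_sub]
    rfl
  rw [hval, norm_mul, Complex.norm_real]
  by_cases h0 : band τ j x = 0
  · rw [h0, norm_zero, mul_zero]; positivity
  have hx := mem_Icc_of_band_ne_zero h0
  have hb : ‖band τ j x‖ ≤ 1 := ((band τ j).norm_coe_le_norm x).trans (norm_band_le τ j)
  have h1 : (i : ℝ) ≤ j + 2 := by exact_mod_cast hij
  have h2 : (j : ℝ) ≤ i + 2 := by exact_mod_cast hji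
  have h3 : ‖φ x - (ε * i + c)‖ ≤ 4 * ε := by
    rw [hτ, Real.norm_eq_abs, show ε * τ x + c - (ε * i + c) = (τ x - i) * ε by ring, abs_mul,
      abs_of_pos hε]
    gcongr
    rw [abs_le]
    constructor <;> linarith [hx.1, hx.2]
  calc _ ≤ 4 * ε * 1 := by gcongr
    _ = _ := mul_one _

/-- Operators in `Psi m` commute with real continuous functions up to compact operators. With
`χ i` a band partition for `φ`, the commutator is the sum of the operators
`χ i ^ 2 [φ, P] χ j ^ 2`. Those with `i`, `j` far apart are compact; the sum of the others has small
norm, because `φ` varies little on neighbouring bands. -/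
theorem isCompactOperator_commutator {m : C(T, ℂ) →⋆ₐ[ℂ] (H →L[ℂ] H)} {P : H →L[ℂ] H}
    (hP : P ∈ Psi m) (φ : C(T, ℝ)) :
    IsCompactOperator (m (toComplex φ) * P - P * m (toComplex φ) : H →L[ℂ] H) := by
  set f := toComplex φ
  set D : H →L[ℂ] H := m f * P - P * m f with hD
  have key : ∀ ε > 0, ∃ K : H →L[ℂ] H, IsCompactOperator K ∧ ‖D - K‖ ≤ (8 * ε * ‖P‖) * 5 := by
    intro ε hε
    -- `τ` rescales `φ` so that bands of width `2` for `τ` have width `2 * ε` for `φ`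
    let τ : C(T, ℝ) := ⟨fun x ↦ (φ x + ‖φ‖) / ε + 1, by fun_prop⟩
    let c : ℝ := -‖φ‖ - ε
    have hτ : ∀ x, φ x = ε * τ x + c := fun x ↦ by
      simp only [τ, c, ContinuousMap.coe_mk]
      field_simp
      ring
    have h1 : ∀ x, 1 ≤ τ x := fun x ↦ by
      have := (abs_le.1 (φ.norm_coe_le_norm x)).1
      have : 0 ≤ (φ x + ‖φ‖) / ε := div_nonneg (by linarith) hε.le
      simpa [τ] using this
    obtain ⟨n, hn'⟩ := exists_nat_ge (‖τ‖)
    have hn : ∀ x, τ x ≤ n := fun x ↦ ((le_abs_self _).trans (τ.norm_coe_le_norm x)).trans hn'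
    let χ : ℕ → H →L[ℂ] H := fun i ↦ m (band τ i)
    have hχ1 : ∑ i ∈ Finset.range n, χ i * χ i = 1 := by
      rw [← map_one m, ← sum_band_mul_band h1 hn, map_sum]
      simp only [map_mul, χ]
    have hcomm (i : ℕ) : m f * χ i = χ i * m f := by
      rw [← map_mul, ← map_mul, mul_comm]
    let t : ℕ × ℕ → H →L[ℂ] H := fun p ↦ χ p.1 * (χ p.1 * D * χ p.2) * χ p.2
    let R := Finset.range n ×ˢ Finset.range n
    let near : ℕ × ℕ → Prop := fun p ↦ p.1 ≤ p.2 + 2 ∧ p.2 ≤ p.1 + 2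
    have hsum : D = ∑ p ∈ R, t p := by
      conv_lhs => rw [← one_mul D, ← mul_one (1 * D), ← hχ1]
      rw [Finset.sum_mul, Finset.sum_mul_sum, Finset.sum_product]
      refine Finset.sum_congr rfl fun i _ ↦ Finset.sum_congr rfl fun j _ ↦ ?_
      simp only [t, mul_assoc]
    have hsplit : ∑ p ∈ R with near p, t p + ∑ p ∈ R with ¬ near p, t p = D := by
      rw [hsum]
      exact Finset.sum_filter_add_sum_filter_not _ _ _
    refine ⟨∑ p ∈ R with ¬ near p, t p, ?_, ?_⟩
    · refine (compactOperator (RingHom.id ℂ) H H).sum_mem fun p hp ↦ ?_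
      change IsCompactOperator (t p)
      have hp : ¬ near p := (Finset.mem_filter.1 hp).2
      have hdis : Disjoint (tsupport (band τ p.1)) (tsupport (band τ p.2)) := by
        refine Set.disjoint_left.2 fun x hx hx' ↦ hp ?_
        have ha := mem_Icc_of_mem_tsupport_band hx
        have hb := mem_Icc_of_mem_tsupport_band hx'
        constructor
        · exact_mod_cast ha.1.trans hb.2
        · exact_mod_cast hb.1.trans ha.2
      have hc : IsCompactOperator (χ p.1 * P * χ p.2 : H →L[ℂ] H) := hP _ _ hdis
      have ht : t p = (χ p.1 * m f) * (χ p.1 * P * χ p.2) * χ p.2 -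
          χ p.1 * (χ p.1 * P * χ p.2) * (m f * χ p.2) := by
        simp only [t, hD, mul_sub, sub_mul, mul_assoc, hcomm]
        rw [← mul_assoc (χ p.1) (m f) (P * _), ← hcomm]
        simp only [mul_assoc]
      rw [ht]
      exact ((hc.clm_comp (χ p.1 * m f)).comp_clm (χ p.2)).sub
        ((hc.clm_comp (χ p.1)).comp_clm (m f * χ p.2))
    · rw [← hsplit, add_sub_cancel_right]
      have hstar (i : ℕ) : star (χ i) = χ i := by
        simp only [χ]
        rw [← map_star, star_band]
      have hbound : ∀ p ∈ R.filter near, ‖χ p.1 * D * χ p.2‖ ≤ 8 * ε * ‖P‖ := by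
        intro p hp
        obtain ⟨hp1, hp2⟩ : near p := (Finset.mem_filter.1 hp).2
        let l : H →L[ℂ] H := algebraMap ℂ _ ((ε * p.1 + c : ℝ) : ℂ)
        have hl : m (f - algebraMap ℂ _ ((ε * p.1 + c : ℝ) : ℂ)) = m f - l := by
          rw [map_sub, AlgHomClass.commutes]
        have hχ (i : ℕ) : ‖χ i‖ ≤ 1 := (norm_rep_le m _).trans (norm_band_le τ i)
        have ha : ‖χ p.1 * (m f - l)‖ ≤ 4 * ε := by
          rw [← hl, ← map_mul, mul_comm]
          exact (norm_rep_le m _).trans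
            (norm_sub_mul_band_le hε hτ (Nat.le_add_right _ 2) (Nat.le_add_right _ 2))
        have hb : ‖(m f - l) * χ p.2‖ ≤ 4 * ε := by
          rw [← hl, ← map_mul]
          exact (norm_rep_le m _).trans (norm_sub_mul_band_le hε hτ hp1 hp2)
        have hlP : l * P = P * l := Algebra.commutes _ _
        have : χ p.1 * D * χ p.2 =
            (χ p.1 * (m f - l)) * P * χ p.2 - χ p.1 * P * ((m f - l) * χ p.2) := by
          have : D = (m f - l) * P - P * (m f - l) := by
            rw [hD, sub_mul, mul_sub, hlP]
            abel
          rw [this]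
          simp only [mul_sub, sub_mul, mul_assoc]
        rw [this]
        calc _ ≤ ‖(χ p.1 * (m f - l)) * P * χ p.2‖ + ‖χ p.1 * P * ((m f - l) * χ p.2)‖ :=
              norm_sub_le _ _
          _ ≤ 4 * ε * ‖P‖ * 1 + 1 * ‖P‖ * (4 * ε) := by
            refine add_le_add ((norm_mul_le_of_le (norm_mul_le_of_le ha le_rfl) (hχ _)))
              (norm_mul_le_of_le (norm_mul_le_of_le (hχ _) le_rfl) hb)
          _ = _ := by ring
      have hfst (u : H) : ∑ p ∈ R with near p, ‖χ p.1 u‖ ^ 2 ≤ 5 * ‖u‖ ^ 2 := by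
        rw [Finset.sum_filter, Finset.sum_product, ← sum_norm_band_sq (m := m) h1 hn u,
          Finset.mul_sum]
        refine Finset.sum_le_sum fun i _ ↦ ?_
        rw [← Finset.sum_filter]
        change ∑ j ∈ Finset.range n with i ≤ j + 2 ∧ j ≤ i + 2, ‖χ i u‖ ^ 2 ≤ 5 * ‖χ i u‖ ^ 2
        rw [Finset.sum_const, nsmul_eq_mul, Finset.filter_congr fun j _ ↦ and_comm]
        gcongr
        exact_mod_cast card_filter_near_le n i
      have hsnd (u : H) : ∑ p ∈ R with near p, ‖χ p.2 u‖ ^ 2 ≤ 5 * ‖u‖ ^ 2 := by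
        rw [Finset.sum_filter, Finset.sum_product_right, ← sum_norm_band_sq (m := m) h1 hn u,
          Finset.mul_sum]
        refine Finset.sum_le_sum fun j _ ↦ ?_
        rw [← Finset.sum_filter]
        change ∑ i ∈ Finset.range n with i ≤ j + 2 ∧ j ≤ i + 2, ‖χ j u‖ ^ 2 ≤ 5 * ‖χ j u‖ ^ 2
        rw [Finset.sum_const, nsmul_eq_mul]
        gcongr
        exact_mod_cast card_filter_near_le n j
      have := norm_sum_adjoint_mul_mul_le (R.filter near) (fun p ↦ χ p.1)
        (fun p ↦ χ p.1 * D * χ p.2) (fun p ↦ χ p.2) (c := 8 * ε * ‖P‖) (k := 5) (by positivity)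
        (by norm_num) hbound hfst hsnd
      simpa only [hstar] using this
  have hclosed : IsClosed {A : H →L[ℂ] H | IsCompactOperator A} :=
    isClosed_setOfPred_isCompactOperator
  change D ∈ {A : H →L[ℂ] H | IsCompactOperator A}
  rw [← hclosed.closure_eq]
  refine Metric.mem_closure_iff.2 fun δ hδ ↦ ?_
  obtain ⟨K, hK, hDK⟩ := key (δ / (40 * (‖P‖ + 1))) (by positivity)
  refine ⟨K, hK, ?_⟩
  rw [dist_eq_norm]
  refine hDK.trans_lt ?_
  have : 8 * (δ / (40 * (‖P‖ + 1))) * ‖P‖ * 5 = δ * (‖P‖ / (‖P‖ + 1)) := by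
    field_simp
    ring
  rw [this]
  have h2 : ‖P‖ / (‖P‖ + 1) < 1 := by
    rw [div_lt_one (by positivity)]
    linarith
  nlinarith

end Commutator

/-! ### Simonenko's principle for representations without atoms -/

section Abstract

variable {T : Type*} [TopologicalSpace T] [CompactSpace T]
  {H : Type*} [NormedAddCommGroup H] [InnerProductSpace ℂ H] [CompleteSpace H]

omit [CompactSpace T] in
theorem tsupport_toComplex (φ : C(T, ℝ)) : tsupport (toComplex φ) = tsupport φ := by
  refine congrArg closure (Set.ext fun x ↦ ?_)
  exact not_congr Complex.ofReal_eq_zero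

/-- Patching local inverses with a partition of unity yields a parametrix, since commutators with
the functions in the partition are compact. -/
theorem IsLocallyInvertible.isFredholm [T2Space T] {m : C(T, ℂ) →⋆ₐ[ℂ] (H →L[ℂ] H)}
    {P : H →L[ℂ] H} (hP : P ∈ Psi m) (h : IsLocallyInvertible m P) : P.IsFredholm := by
  choose V hV A B hAB using h
  obtain ⟨t, -, ht⟩ := isCompact_univ.elim_nhds_subcover (fun x ↦ interior (V x))
    fun x _ ↦ interior_mem_nhds.2 (hV x)
  obtain ⟨f, hf⟩ := PartitionOfUnity.exists_isSubordinate isClosed_univ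
    (fun x : t ↦ interior (V x)) (fun _ ↦ isOpen_interior) (by simpa [Set.iUnion_subtype] using ht)
  let φ : t → H →L[ℂ] H := fun i ↦ m (toComplex (f i))
  have hsum : ∑ i, φ i = 1 := by
    rw [← map_one m, ← map_sum]
    congr 1
    ext x
    have hx : ∑ i, f i x = 1 := by
      rw [← finsum_eq_sum_of_fintype]
      exact f.sum_eq_one (Set.mem_univ x)
    rw [ContinuousMap.sum_apply, ContinuousMap.one_apply, ← Complex.ofReal_one, ← hx,
      Complex.ofReal_sum]
    rfl
  have hloc (i : t) : A i * (P * φ i) = φ i ∧ φ i * (P * B i) = φ i :=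
    hAB i _ ((tsupport_toComplex (f i)).trans_subset ((hf i).trans interior_subset))
  have hcomm (i : t) : IsCompactOperator (φ i * P - P * φ i : H →L[ℂ] H) :=
    isCompactOperator_commutator hP (f i)
  refine isFredholm_of_isCompactOperator (A := ∑ i : t, A i * φ i) (B := ∑ i : t, φ i * B i) ?_ ?_
  · have : (∑ i : t, A i * φ i) * P - 1 = ∑ i : t, A i * (φ i * P - P * φ i) := by
      rw [← hsum, Finset.sum_mul, ← Finset.sum_sub_distrib]
      refine Finset.sum_congr rfl fun i _ ↦ ?_
      rw [mul_sub, (hloc i).1, mul_assoc]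
    rw [this]
    exact (compactOperator (RingHom.id ℂ) H H).sum_mem fun i _ ↦ (hcomm i).clm_comp (A i)
  · have : P * (∑ i : t, φ i * B i) - 1 = -∑ i : t, (φ i * P - P * φ i) * B i := by
      rw [← hsum, Finset.mul_sum, ← Finset.sum_sub_distrib, ← Finset.sum_neg_distrib]
      refine Finset.sum_congr rfl fun i _ ↦ ?_
      rw [sub_mul, mul_assoc, (hloc i).2, mul_assoc, neg_sub]
    rw [this]
    exact (compactOperator (RingHom.id ℂ) H H).neg_mem <|
      (compactOperator (RingHom.id ℂ) H H).sum_mem fun i _ ↦ (hcomm i).comp_clm (B i)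

/-- The representation `m` of `C(T)` has no atoms: for functions `χ` with `|χ| ≤ 1`, the vectors
`m χ u` tend to zero as the support of `χ` shrinks to a point. Equivalently, points are null sets
for the spectral measure of `m`. -/
def HasNoAtoms (m : C(T, ℂ) →⋆ₐ[ℂ] (H →L[ℂ] H)) : Prop :=
  ∀ (x : T) (u : H), ∀ ε > 0, ∃ U ∈ 𝓝 x, ∀ χ : C(T, ℂ),
    tsupport χ ⊆ U → ‖χ‖ ≤ 1 → ‖m χ u‖ ≤ ε

/-- Equicontinuous operators that converge to zero strongly do so uniformly on compact sets. -/
theorem HasNoAtoms.exists_norm_mul_le {m : C(T, ℂ) →⋆ₐ[ℂ] (H →L[ℂ] H)} (hm : HasNoAtoms m)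
    (x : T) {K : H →L[ℂ] H} (hK : IsCompactOperator K) {ε : ℝ} (hε : 0 < ε) :
    ∃ U ∈ 𝓝 x, ∀ χ : C(T, ℂ), tsupport χ ⊆ U → ‖χ‖ ≤ 1 → ‖m χ * K‖ ≤ ε := by
  have hc := hK.isCompact_closure_image_closedBall (f := K.toLinearMap) 1
  obtain ⟨t, ht, hcov⟩ := Metric.totallyBounded_iff.1 hc.totallyBounded (ε / 2) (half_pos hε)
  choose U hU hUχ using fun y ↦ hm x y (ε / 2) (half_pos hε)
  refine ⟨⋂ y ∈ t, U y, (Filter.biInter_mem ht).2 fun y _ ↦ hU y, fun χ hχ hχ1 ↦ ?_⟩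
  refine ContinuousLinearMap.opNorm_le_of_unit_norm hε.le fun u hu ↦ ?_
  have hmem : K u ∈ closure (K.toLinearMap '' Metric.closedBall 0 1) :=
    subset_closure ⟨u, by simp [hu], rfl⟩
  obtain ⟨y, hy, huy⟩ := Set.mem_iUnion₂.1 (hcov hmem)
  have h1 : ‖m χ (K u - y)‖ ≤ 1 * (ε / 2) := by
    refine (m χ).le_of_opNorm_le_of_le ((norm_rep_le m χ).trans hχ1) ?_
    rw [← dist_eq_norm]
    exact (Metric.mem_ball.1 huy).le
  have h2 : ‖m χ y‖ ≤ ε / 2 := hUχ y χ (hχ.trans (Set.biInter_subset_of_mem hy)) hχ1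
  calc ‖m χ (K u)‖ = ‖m χ (K u - y) + m χ y‖ := by rw [← map_add, sub_add_cancel]
    _ ≤ 1 * (ε / 2) + ε / 2 := norm_add_le_of_le h1 h2
    _ = ε := by ring

/-- If `Q` inverts `P` up to finite rank operators, and `χ = 1` near `x` has small support, then
`1 - (1 - Q P) m χ` and `1 - m χ (1 - P Q)` are invertible by Neumann's series, and correct `Q` to
local inverses of `P`. -/
theorem HasNoAtoms.isLocallyInvertible [T2Space T] {m : C(T, ℂ) →⋆ₐ[ℂ] (H →L[ℂ] H)}
    (hm : HasNoAtoms m) {P : H →L[ℂ] H} (hP : P.IsFredholm) : IsLocallyInvertible m P := by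
  intro x
  obtain ⟨Q, hl, hr⟩ := hP.exists_isQuasiInverse
  let K : H →L[ℂ] H := Q * P - 1
  let L : H →L[ℂ] H := P * Q - 1
  have hK : K.toLinearMap.HasFiniteRange :=
    LinearMap.FiniteRangeSetoid.equiv_iff_hasFiniteRange.1 hl
  have hL : L.toLinearMap.HasFiniteRange :=
    LinearMap.FiniteRangeSetoid.equiv_iff_hasFiniteRange.1 hr
  obtain ⟨U, hU, hUK⟩ := hm.exists_norm_mul_le x
    (isCompactOperator_of_hasFiniteRange (hasFiniteRange_adjoint hK)) one_half_pos
  obtain ⟨W, hW, hWL⟩ := hm.exists_norm_mul_le x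
    (isCompactOperator_of_hasFiniteRange hL) one_half_pos
  obtain ⟨V, hV, hVc, hVUW⟩ := exists_mem_nhds_isClosed_subset
    (interior_mem_nhds.2 (Filter.inter_mem hU hW))
  obtain ⟨χ, hχs, hχ1, hχ01⟩ := exists_tsupport_one_of_isOpen_isClosed isOpen_interior
    isClosed_closure.isCompact hVc hVUW
  have hχUW : tsupport (toComplex χ) ⊆ U ∩ W :=
    (tsupport_toComplex χ).trans_subset (hχs.trans interior_subset)
  have hχn : ‖toComplex χ‖ ≤ 1 := by
    refine (ContinuousMap.norm_le _ zero_le_one).2 fun y ↦ ?_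
    change ‖((χ y : ℝ) : ℂ)‖ ≤ 1
    rw [Complex.norm_real, Real.norm_of_nonneg (hχ01 y).1]
    exact (hχ01 y).2
  have hχstar : star (toComplex χ) = toComplex χ := by
    ext y
    exact Complex.conj_ofReal _
  set X : H →L[ℂ] H := m (toComplex χ) with hX
  have hKX : ‖-(K * X)‖ < 1 := by
    have : star (X * ContinuousLinearMap.adjoint K) = K * X := by
      rw [star_mul, ← ContinuousLinearMap.star_eq_adjoint, star_star, hX, ← map_star, hχstar]
    rw [norm_neg, ← this, norm_star]
    exact (hUK _ (hχUW.trans Set.inter_subset_left) hχn).trans_lt one_half_lt_one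
  have hXL : ‖-(X * L)‖ < 1 := by
    rw [norm_neg]
    exact (hWL _ (hχUW.trans Set.inter_subset_right) hχn).trans_lt one_half_lt_one
  obtain ⟨u, hu⟩ := isUnit_one_sub_of_norm_lt_one hKX
  obtain ⟨v, hv⟩ := isUnit_one_sub_of_norm_lt_one hXL
  refine ⟨V, hV, ↑u⁻¹ * Q, Q * ↑v⁻¹, fun φ hφ ↦ ?_⟩
  have hχφ : toComplex χ * φ = φ := by
    ext y
    by_cases hy : φ y = 0
    · rw [ContinuousMap.mul_apply, hy, mul_zero]
    · have : χ y = 1 := hχ1 (hφ (subset_tsupport _ hy))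
      rw [ContinuousMap.mul_apply]
      change ((χ y : ℝ) : ℂ) * φ y = φ y
      rw [this, Complex.ofReal_one, one_mul]
  have hXφ : X * m φ = m φ := by rw [hX, ← map_mul, hχφ]
  have hφX : m φ * X = m φ := by rw [hX, ← map_mul, mul_comm, hχφ]
  constructor
  · change ↑u⁻¹ * Q * (P * m φ) = m φ
    have : Q * (P * m φ) = ↑u * m φ := by
      rw [hu, sub_neg_eq_add, add_mul, one_mul, mul_assoc, hXφ, sub_mul, mul_assoc, one_mul]
      abel
    rw [mul_assoc, this, ← mul_assoc, Units.inv_mul, one_mul]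
  · change m φ * (P * (Q * ↑v⁻¹)) = m φ
    have : m φ * (P * Q) = m φ * ↑v := by
      rw [hv, sub_neg_eq_add, mul_add, mul_one, ← mul_assoc (m φ) X, hφX, mul_sub, mul_one]
      abel
    rw [← mul_assoc P, ← mul_assoc, this, mul_assoc, Units.mul_inv, mul_one]

end Abstract

/-! ### Points are null sets for the Riemannian volume -/

section Volume

variable {n : ℕ} {M : Type*} [TopologicalSpace M] [ChartedSpace (EuclideanSpace ℝ (Fin n)) M]
  [IsManifold (𝓡 n) ∞ M] [MeasurableSpace M] [BorelSpace M]

theorem chartVolume_singleton [T1Space M] (hn : 1 ≤ n)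
    (g : ContMDiffRiemannianMetric (𝓡 n) ∞ (EuclideanSpace ℝ (Fin n))
      (fun x : M ↦ TangentSpace (𝓡 n) x))
    (e : OpenPartialHomeomorph M (EuclideanSpace ℝ (Fin n))) (x : M) :
    chartVolume g e {x} = 0 := by
  have : Nonempty (Fin n) := ⟨⟨0, hn⟩⟩
  unfold chartVolume
  rw [Measure.map_apply_of_aemeasurable (aemeasurable_chart_symm e _) (measurableSet_singleton x)]
  refine withDensity_absolutelyContinuous _ _ ?_
  rw [Measure.restrict_apply₀' e.open_target.measurableSet.nullMeasurableSet]
  refine Set.Subsingleton.measure_zero (fun u hu v hv ↦ ?_) _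
  exact e.symm.injOn hu.2 hv.2 (hu.1.trans hv.1.symm)

/-- Points are null sets for the supremum of the chart volumes, even if the atlas is uncountable:
the restriction of the supremum to the complement of a point still is an upper bound. -/
theorem riemannianVolume_singleton [T1Space M] (hn : 1 ≤ n)
    (g : ContMDiffRiemannianMetric (𝓡 n) ∞ (EuclideanSpace ℝ (Fin n))
      (fun x : M ↦ TangentSpace (𝓡 n) x)) (x : M) :
    riemannianVolume g {x} = 0 := by
  have h : riemannianVolume g ≤ (riemannianVolume g).restrict {x}ᶜ := by
    refine iSup₂_le fun e he ↦ ?_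
    have hle : chartVolume g e ≤ riemannianVolume g :=
      le_iSup₂ (f := fun e (_ : e ∈ atlas (EuclideanSpace ℝ (Fin n)) M) ↦ chartVolume g e) e he
    calc chartVolume g e = (chartVolume g e).restrict {x}ᶜ := by
          refine (Measure.restrict_eq_self_of_ae_mem ?_).symm
          exact compl_mem_ae_iff.2 (chartVolume_singleton hn g e x)
      _ ≤ (riemannianVolume g).restrict {x}ᶜ := Measure.restrict_mono le_rfl hle
  refine le_antisymm ((h {x}).trans_eq ?_) zero_le
  rw [Measure.restrict_apply (measurableSet_singleton x), Set.inter_compl_self, measure_empty]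

end Volume

/-! ### The multiplication representation has no atoms -/

section Multiplication

variable {B : Type*} [TopologicalSpace B] [CompactSpace B] [MeasurableSpace B] [BorelSpace B]
  {F : Type*} [NormedAddCommGroup F] [NormedSpace ℂ F] [FiniteDimensional ℂ F]
  {E : B → Type*} [TopologicalSpace (TotalSpace F E)]
  [∀ x, NormedAddCommGroup (E x)] [∀ x, InnerProductSpace ℂ (E x)]
  [FiberBundle F E] [VectorBundle ℂ F E] [IsHermitianBundle F E] {μ : Measure B}

theorem SqIntegrableSection.norm_sq_eq (s : SqIntegrableSection F E μ) :
    ‖s‖ ^ 2 = ∫ x, ‖s x‖ ^ 2 ∂μ := by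
  rw [@norm_sq_eq_re_inner ℂ, inner_def, ← integral_re (s.integrable_inner s)]
  exact integral_congr_ae (.of_forall fun x ↦ (norm_sq_eq_re_inner (𝕜 := ℂ) (s x)).symm)

theorem SqIntegrableSection.integrable_norm_sq (s : SqIntegrableSection F E μ) :
    Integrable (fun x ↦ ‖s x‖ ^ 2) μ := by
  refine (s.integrable_inner s).re.congr (.of_forall fun x ↦ ?_)
  exact (norm_sq_eq_re_inner (𝕜 := ℂ) (s x)).symm

theorem norm_mulSection_sq_le (s : SqIntegrableSection F E μ) {χ : C(B, ℂ)} {U : Set B}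
    (hU : MeasurableSet U) (hχ : tsupport χ ⊆ U) (hχ1 : ‖χ‖ ≤ 1) :
    ‖mulSection χ s‖ ^ 2 ≤ ∫ x in U, ‖s x‖ ^ 2 ∂μ := by
  rw [SqIntegrableSection.norm_sq_eq, ← integral_indicator hU]
  refine integral_mono (SqIntegrableSection.integrable_norm_sq _)
    (s.integrable_norm_sq.indicator hU) fun x ↦ ?_
  change ‖mulSection χ s x‖ ^ 2 ≤ U.indicator (fun x ↦ ‖s x‖ ^ 2) x
  rw [mulSection_apply, norm_smul]
  by_cases hx : x ∈ U
  · rw [Set.indicator_of_mem hx]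
    have : ‖χ x‖ ≤ 1 := (χ.norm_coe_le_norm x).trans hχ1
    gcongr
    exact mul_le_of_le_one_left (norm_nonneg _) this
  · rw [Set.indicator_of_notMem hx, image_eq_zero_of_notMem_tsupport fun h ↦ hx (hχ h)]
    simp

omit [CompactSpace B] in
/-- The integral of an integrable function over small neighbourhoods of a null point is small. -/
theorem exists_nhds_setIntegral_lt [FirstCountableTopology B] [T1Space B] {x : B}
    (hx : μ {x} = 0) {f : B → ℝ} (hf : Integrable f μ) {δ : ℝ} (hδ : 0 < δ) :
    ∃ U, IsOpen U ∧ x ∈ U ∧ ∫ y in U, f y ∂μ < δ := by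
  obtain ⟨b, hb, hbas⟩ := (nhds_basis_opens x).exists_antitone_subbasis
  have hlim := hbas.antitone.tendsto_setIntegral (μ := μ) (f := f)
    (fun i ↦ (hb i).2.measurableSet) hf.integrableOn
  have hinter : ⋂ i, b i = {x} := by
    simpa [ker_nhds] using hbas.toHasBasis.ker.symm
  rw [hinter, setIntegral_measure_zero f hx] at hlim
  obtain ⟨i, hi⟩ := (hlim.eventually (gt_mem_nhds hδ)).exists
  exact ⟨b i, (hb i).2, (hb i).1, hi⟩

theorem hasNoAtoms_mulRep [FirstCountableTopology B] [T1Space B] (hμ : ∀ x, μ {x} = 0) :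
    HasNoAtoms (mulRep F E μ) := by
  intro x u ε hε
  obtain ⟨s, hs⟩ := Metric.denseRange_iff.1
    (UniformSpace.Completion.denseRange_coe (α := SqIntegrableSection F E μ)) u (ε / 2)
    (half_pos hε)
  obtain ⟨U, hUo, hxU, hU⟩ := exists_nhds_setIntegral_lt (hμ x) s.integrable_norm_sq
    (δ := (ε / 2) ^ 2) (by positivity)
  refine ⟨U, hUo.mem_nhds hxU, fun χ hχ hχ1 ↦ ?_⟩
  have h1 : ‖mulRep F E μ χ (s : L2 F E μ)‖ ≤ ε / 2 := by
    change ‖(mulSection χ).completion (s : L2 F E μ)‖ ≤ ε / 2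
    rw [ContinuousLinearMap.completion_apply_coe, UniformSpace.Completion.norm_coe]
    refine (sq_le_sq₀ (norm_nonneg _) (by positivity)).1 ?_
    exact (norm_mulSection_sq_le s hUo.measurableSet hχ hχ1).trans hU.le
  have h2 : ‖mulRep F E μ χ (u - s)‖ ≤ 1 * (ε / 2) := by
    refine ContinuousLinearMap.le_of_opNorm_le_of_le _ ((norm_rep_le _ χ).trans hχ1) ?_
    rw [← dist_eq_norm]
    exact hs.le
  calc ‖mulRep F E μ χ u‖ = ‖mulRep F E μ χ (u - s) + mulRep F E μ χ s‖ := by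
        rw [← map_add, sub_add_cancel]
    _ ≤ 1 * (ε / 2) + ε / 2 := norm_add_le_of_le h2 h1
    _ = ε := by ring

end Multiplication

end Simonenko

theorem mainTheorem6
    {n : ℕ} (hn : 1 ≤ n)
    {M : Type*} [TopologicalSpace M] [CompactSpace M] [T2Space M]
    [ChartedSpace (EuclideanSpace ℝ (Fin n)) M] [IsManifold (𝓡 n) ∞ M]
    [MeasurableSpace M] [BorelSpace M]
    (g : ContMDiffRiemannianMetric (𝓡 n) ∞ (EuclideanSpace ℝ (Fin n))
      (fun x : M ↦ TangentSpace (𝓡 n) x))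
    {F : Type*} [NormedAddCommGroup F] [NormedSpace ℂ F] [FiniteDimensional ℂ F]
    {E : M → Type*} [TopologicalSpace (TotalSpace F E)]
    [∀ x, NormedAddCommGroup (E x)] [∀ x, InnerProductSpace ℂ (E x)]
    [FiberBundle F E] [VectorBundle ℂ F E] [Simonenko.IsHermitianBundle F E]
    (P : Simonenko.L2 F E (Simonenko.riemannianVolume g) →L[ℂ]
      Simonenko.L2 F E (Simonenko.riemannianVolume g))
    (hP : P ∈ Simonenko.Psi (Simonenko.mulRep F E (Simonenko.riemannianVolume g))) :
    Simonenko.IsLocallyInvertible (Simonenko.mulRep F E (Simonenko.riemannianVolume g)) P ↔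
      P.IsFredholm := by
  have : SecondCountableTopology M :=
    ChartedSpace.secondCountable_of_sigmaCompact (EuclideanSpace ℝ (Fin n)) M
  exact ⟨fun h ↦ h.isFredholm hP, fun h ↦
    (Simonenko.hasNoAtoms_mulRep (Simonenko.riemannianVolume_singleton hn g)).isLocallyInvertible h⟩
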